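/- Let $X$ be a Hausdorff locally convex space over $\mathbb T\in\{\mathbb R,\mathbb C\}$ whose topology is generated by seminorms $\|\cdot\|_\alpha$, $\alpha\in\Omega$, and let $\mathcal L(X)$ be the space of continuous linear operators on $X$. Let $\mathcal F_X$ be the set of all $F:[0,\infty)\to\mathcal L(X)$ such that: (1) $F(0)=I$; (2) for each $s\ge 0$ the family $\{F(d/n)^m : m,n\in\mathbb N,\ d\ge 0,\ md/n\le s\}$ is equicontinuous, i.e. for every $\alpha$ there are finitely many $\alpha_i\in\Omega$ and $b_i>0$ with $\|Tx\|_\alpha\le\sum_i b_i\|x\|_{\alpha_i}$ for all $T$ in the family and all $x\in X$; (3) the set of all $f\in X$ for which there are $g\in X$ and $(f_s)_{s\geq 0}\subset X$ with $\lim_{s\to0+}f_s=f$ and $\lim_{s\to 0+}s^{-1}(F(s)-F(0))f_s=g$ is dense in $X$. For $F\in\mathcal F_X$ the vector $g$ in (3) is uniquely determined by $f$; the linear operator $f\mapsto g$ defined on the set in (3) is denoted by $F'_{ef}(0)$, the effective derivative of $F$ at $0$. **Theorem.** Let $Z$ be a densely defined linear operator in $X$, let $t>0$, and let $F\in\mathcal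 F_X$ satisfy $D(Z)\subset D(F'_{ef}(0))$ and $F'_{ef}(0)g=Zg$ for $g\in D(Z)$. Then $Z$ is closable, and for every $l>0$ and every $h\in D(\overline Z)$ the following holds. There exists a local solution on $[0,l)$ of $$f'(v)=\overline Z f(v),\qquad f(0)=h,$$ that is, a function $f:[0,l)\to X$ with $f(0)=h$ such that for every $v\in[0,l)$ one has $f(v)\in D(\overline Z)$ and $f$ is differentiable at $v$ (one-sidedly at $v=0$) with $f'(v)=\overline Zf(v)$, if and only if the following two conditions are satisfied: (a) for every $s\in[0,l)$, each subsequence of $\{F(t/n)^{[ns/t]}h\}_{n\in\mathbb N}$ has a further subsequence that converges in $X$; (b) for every $s\in[0,l)$ there is a sequence $f_n^s\in D(\overline Z)$, $n\in\mathbb N$, such that $F(t/n)^{[ns/t]}h-f_n^s\to 0$ weakly and each subsequence of $\{\overline Zf_n^s\}_{n\in\mathbb N}$ has a further subsequence that converges weakly in $X$. Here $[\cdot]$ denotes the integer part. Moreover, if (a) and (b) are satisfied, then every such local solution $f$ satisfies $$f(v)=\lim_{n\to\infty}F(v/n)^n h,\qquad v\in[0,l).$$ -/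

import Mathlib

open Filter Topology

noncomputable section

namespace ChernoffLC

/-!
Throughout, `X` is a vector space over `𝕜` (which is `ℝ` or `ℂ`) whose topology is generated by a
family of seminorms `p i`, `i : ι`.  A function `[0, ∞) → L(X)` is represented by a function on `ℝ`;
only its values at nonnegative arguments are ever used.  Likewise a function on `[0, l)` is
represented by a function on `ℝ` of which only the values on `[0, l)` are used.
-/

/-- The family of operators `F(d/n)^m` with `m, n` positive integers, `d ≥ 0` and `m d / n ≤ s`. -/
def powerFamily {𝕜 X : Type*} [RCLike 𝕜] [AddCommGroup X] [Module 𝕜 X] [TopologicalSpace X]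
    (F : ℝ → X →L[𝕜] X) (s : ℝ) : Set (X →L[𝕜] X) :=
  {T | ∃ (m n : ℕ) (d : ℝ), 0 < m ∧ 0 < n ∧ 0 ≤ d ∧ (m : ℝ) * d / (n : ℝ) ≤ s ∧
    T = (F (d / (n : ℝ))) ^ m}

/-- Equicontinuity of a set of operators, with respect to the generating seminorms: every
seminorm of `T x` is bounded, uniformly over `T` in the set, by a finite positive combination of
seminorms of `x`. -/
def EquicontinuousFamily {𝕜 X ι : Type*} [RCLike 𝕜] [AddCommGroup X] [Module 𝕜 X]
    [TopologicalSpace X] (p : SeminormFamily 𝕜 X ι) (S : Set (X →L[𝕜] X)) : Prop :=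
  ∀ α : ι, ∃ (A : Finset ι) (b : ι → ℝ), (∀ i ∈ A, 0 < b i) ∧
    ∀ T ∈ S, ∀ x : X, p α (T x) ≤ ∑ i ∈ A, b i * p i x

/-- The class of functions `F : [0, ∞) → L(X)` with `F(0) = I` whose families of powers
`F(d/n)^m`, `m d / n ≤ s`, are equicontinuous for every `s ≥ 0`. -/
structure ClassE {𝕜 X ι : Type*} [RCLike 𝕜] [AddCommGroup X] [Module 𝕜 X]
    [TopologicalSpace X] (p : SeminormFamily 𝕜 X ι) (F : ℝ → X →L[𝕜] X) : Prop where
  map_zero : F 0 = ContinuousLinearMap.id 𝕜 X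
  equicontinuous : ∀ s : ℝ, 0 ≤ s → EquicontinuousFamily p (powerFamily F s)

/-- The graph of the many-valued effective derivative of `F` at `0`: the pairs `(f, g)` for which
there are vectors `u h` with `u h → f` and `h⁻¹ (F(h) - F(0)) (u h) → g` as `h → 0+`. -/
def effGraph {𝕜 X : Type*} [RCLike 𝕜] [AddCommGroup X] [Module 𝕜 X] [TopologicalSpace X]
    [IsTopologicalAddGroup X] [ContinuousSMul 𝕜 X] (F : ℝ → X →L[𝕜] X) :
    Submodule 𝕜 (X × X) where
  carrier := {q | ∃ u : ℝ → X, Tendsto u (𝓝[>] 0) (𝓝 q.1) ∧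
    Tendsto (fun h : ℝ => ((h : 𝕜))⁻¹ • (F h - F 0) (u h)) (𝓝[>] 0) (𝓝 q.2)}
  add_mem' := by
    rintro a b ⟨u, hu, hu'⟩ ⟨v, hv, hv'⟩
    refine ⟨fun h => u h + v h, hu.add hv, ?_⟩
    simpa only [map_add, smul_add, Prod.snd_add] using hu'.add hv'
  zero_mem' := by
    refine ⟨fun _ => 0, tendsto_const_nhds, ?_⟩
    simp only [map_zero, smul_zero, Prod.snd_zero]
    exact tendsto_const_nhds
  smul_mem' := by
    rintro c a ⟨u, hu, hu'⟩
    refine ⟨fun h => c • u h, hu.const_smul c, ?_⟩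
    have := hu'.const_smul c
    simpa only [map_smul, smul_comm c, Prod.smul_snd] using this

/-- The effective derivative of `F` at `0`: the linear operator whose graph is `effGraph F` when
this many-valued derivative is single-valued (which is when the effective derivative exists). -/
def effDeriv {𝕜 X : Type*} [RCLike 𝕜] [AddCommGroup X] [Module 𝕜 X] [TopologicalSpace X]
    [IsTopologicalAddGroup X] [ContinuousSMul 𝕜 X] (F : ℝ → X →L[𝕜] X) : X →ₗ.[𝕜] X :=
  (effGraph F).toLinearPMap

/-- The class of those `F` in `ClassE` for which the domain of the many-valued effective
derivative at `0` is dense. -/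
structure ClassF {𝕜 X ι : Type*} [RCLike 𝕜] [AddCommGroup X] [Module 𝕜 X] [TopologicalSpace X]
    [IsTopologicalAddGroup X] [ContinuousSMul 𝕜 X] (p : SeminormFamily 𝕜 X ι)
    (F : ℝ → X →L[𝕜] X) : Prop extends ClassE p F where
  dense_domain : Dense {f : X | ∃ g : X, (f, g) ∈ effGraph F}

/-- `f` is a local solution on `[0, l)` of `f' = A f`, `f(0) = h`.  The derivative at `s` is the
limit of the difference quotients taken within `[0, l)`; in particular it is one-sided at `0`. -/
structure IsLocalSolution {𝕜 X : Type*} [RCLike 𝕜] [AddCommGroup X] [Module 𝕜 X]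
    [TopologicalSpace X] (A : X →ₗ.[𝕜] X) (l : ℝ) (h : X) (f : ℝ → X) : Prop where
  init : f 0 = h
  deriv : ∀ s ∈ Set.Ico 0 l, ∃ hs : f s ∈ A.domain,
    Tendsto (fun v : ℝ => (((v - s : ℝ) : 𝕜))⁻¹ • (f v - f s)) (𝓝[Set.Ico 0 l \ {s}] s)
      (𝓝 (A ⟨f s, hs⟩))

/-- Weak convergence of a sequence, i.e. convergence in `σ(X, X*)`. -/
def WeakTendsto (𝕜 : Type*) {X : Type*} [RCLike 𝕜] [AddCommGroup X] [Module 𝕜 X]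
    [TopologicalSpace X] (u : ℕ → X) (x : X) : Prop :=
  ∀ φ : X →L[𝕜] 𝕜, Tendsto (fun n => φ (u n)) atTop (𝓝 (φ x))

/-- Every subsequence of `u` has a further subsequence that converges in `X`. -/
def SubseqCompact {X : Type*} [TopologicalSpace X] (u : ℕ → X) : Prop :=
  ∀ a : ℕ → ℕ, StrictMono a → ∃ b : ℕ → ℕ, StrictMono b ∧
    ∃ x : X, Tendsto (fun k => u (a (b k))) atTop (𝓝 x)

/-- Every subsequence of `u` has a further subsequence that converges weakly in `X`. -/
def WeakSubseqCompact (𝕜 : Type*) {X : Type*} [RCLike 𝕜] [AddCommGroup X] [Module 𝕜 X]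
    [TopologicalSpace X] (u : ℕ → X) : Prop :=
  ∀ a : ℕ → ℕ, StrictMono a → ∃ b : ℕ → ℕ, StrictMono b ∧
    ∃ x : X, WeakTendsto 𝕜 (fun k => u (a (b k))) x

/-- The approximants `F(t/n)^[n s / t] h`, where `[·]` is the integer part. -/
def approx {𝕜 X : Type*} [RCLike 𝕜] [AddCommGroup X] [Module 𝕜 X] [TopologicalSpace X]
    (F : ℝ → X →L[𝕜] X) (t : ℝ) (h : X) (s : ℝ) (n : ℕ) : X :=
  ((F (t / (n : ℝ))) ^ ⌊(n : ℝ) * s / t⌋₊) h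

/-- Condition (a): for each `s` in `[0, l)` the sequence of approximants is relatively
sequentially compact. -/
def CondA {𝕜 X : Type*} [RCLike 𝕜] [AddCommGroup X] [Module 𝕜 X] [TopologicalSpace X]
    (F : ℝ → X →L[𝕜] X) (t l : ℝ) (h : X) : Prop :=
  ∀ s ∈ Set.Ico 0 l, SubseqCompact (approx F t h s)

/-- Condition (b), for an operator `A`: for each `s` in `[0, l)` there are `u n` in the domain of
`A` such that the approximants minus `u n` tend weakly to `0` and such that the sequence `A (u n)`
is weakly relatively sequentially compact. -/
def CondB {𝕜 X : Type*} [RCLike 𝕜] [AddCommGroup X] [Module 𝕜 X] [TopologicalSpace X]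
    (A : X →ₗ.[𝕜] X) (F : ℝ → X →L[𝕜] X) (t l : ℝ) (h : X) : Prop :=
  ∀ s ∈ Set.Ico 0 l, ∃ u : ℕ → A.domain,
    WeakTendsto 𝕜 (fun n => approx F t h s n - (u n : X)) 0 ∧
    WeakSubseqCompact 𝕜 (fun n => A (u n))

end ChernoffLC

end

/-!
The many-valued effective derivative of `F` is replaced by a larger closed set, `asympGraph F`: the
pairs `(x, y)` with `F(h)^m x - x - h ∑_{k < m} F(h)^k y → 0` as `h → 0+`, uniformly for bounded
`m h`.  Equicontinuity of the powers puts the effective graph and its closure into it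
(`effGraph_subset_asympGraph`, `mem_asympGraph_of_mem_closure`).  Density of the domain makes
`F(h)^m x - x` small for small `m h`, uniformly in `h` (`eventually_pow_sub_le`), so that the sum is
`m h y` up to a small relative error; hence `(0, y)` can lie in `asympGraph F` only for `y = 0`.
This gives closability, and the graph of the closure of `Z` lies in `asympGraph F`.

If `f` is a local solution, then `F(h)^[s/h] h₀ → f(s)` as `h → 0+` through all real steps
(`IsLocalSolution.tendsto_pow`).  The error telescopes over a partition of `[0, s]`, the
contribution of a short interval being small compared with its length.  Since `f'` is not assumed
continuous, the admissible length depends on the point, as in the mean value inequality.  This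
yields conditions (a) and (b), with the values of `f` as auxiliary vectors, and the limit formula.

Conversely, (a) and a diagonal argument give one subsequence of steps along which the approximants
converge to some `f(s)` for every `s`; no completeness of `X` is needed, since equicontinuity in
time carries convergence from a dense set of times to all times at which a cluster value exists.  By
(b) and weak closedness of the closed graph, `f(s)` lies in the domain of the closure of `Z`; let
`g(s)` be the image of `f(s)` under it.  Then `f` has right derivative `g`.  Passing difference
quotients through the limit shows that the powers of `F` carry `g(a)` to `g(a + b)`
(`PowTendsto.velocity`).  So all `g(a)` are limits of powers of `F` applied to the single vector
`g(0)`, whence `g` is uniformly continuous and the first-order expansion of `f` is uniform in the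
base point; this gives the left derivative (`isLocalSolution_of_powTendsto`).
-/

open Filter Topology

noncomputable section

namespace ChernoffLC

/-! ### Equicontinuity of the powers in terms of continuous seminorms -/

section Basic

variable {𝕜 X ι : Type*} [RCLike 𝕜] [AddCommGroup X] [Module 𝕜 X] [TopologicalSpace X]

/-- Local equicontinuity of the powers of `F`, phrased for arbitrary continuous seminorms: the
powers `F(r)^m` with `m r ≤ s`, the zeroth power included, are controlled by one seminorm. -/
def EquicontinuousPowers (F : ℝ → X →L[𝕜] X) : Prop :=
  ∀ q : Seminorm 𝕜 X, Continuous q → ∀ s : ℝ, ∃ q' : Seminorm 𝕜 X, Continuous q' ∧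
    ∀ r : ℝ, 0 ≤ r → ∀ m : ℕ, (m : ℝ) * r ≤ s → ∀ x, q ((F r ^ m) x) ≤ q' x

/-- A finite nonnegative combination of continuous seminorms is a continuous seminorm. -/
theorem exists_seminorm_eq_sum {p : ι → Seminorm 𝕜 X} (hp : ∀ i, Continuous (p i))
    (A : Finset ι) (b : ι → ℝ) (hb : ∀ i ∈ A, 0 ≤ b i) :
    ∃ q : Seminorm 𝕜 X, Continuous q ∧ ∀ x, ∑ i ∈ A, b i * p i x = q x := by
  classical
  induction A using Finset.induction_on with
  | empty => exact ⟨0, continuous_const, fun x => by simp⟩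
  | insert a A ha ih =>
    obtain ⟨q, hq, hqx⟩ := ih fun i hi => hb i (Finset.mem_insert_of_mem hi)
    have hba := hb a (Finset.mem_insert_self _ _)
    refine ⟨(b a).toNNReal • p a + q, ?_, fun x => ?_⟩
    · exact ((hp a).const_smul (b a).toNNReal).add hq
    · rw [Finset.sum_insert ha, hqx, add_apply, smul_apply, NNReal.smul_def,
        Real.coe_toNNReal _ hba, smul_eq_mul]

theorem ClassE.equicontinuousPowers [IsTopologicalAddGroup X] [ContinuousSMul 𝕜 X]
    {p : SeminormFamily 𝕜 X ι} (hp : WithSeminorms p)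
    {F : ℝ → X →L[𝕜] X} (hF : ClassE p F) : EquicontinuousPowers F := by
  have key : ∀ (i : ι) (s : ℝ), ∃ q' : Seminorm 𝕜 X, Continuous q' ∧
      ∀ r : ℝ, 0 ≤ r → ∀ m : ℕ, (m : ℝ) * r ≤ s → ∀ x, p i ((F r ^ m) x) ≤ q' x := by
    intro i s
    obtain ⟨A, b, hb, hT⟩ := hF.equicontinuous (max s 0) (le_max_right _ _) i
    obtain ⟨q, hq, hqx⟩ := exists_seminorm_eq_sum hp.continuous_seminorm A b fun i hi => (hb i hi).le
    refine ⟨q + p i, hq.add (hp.continuous_seminorm i), fun r hr m hm x => ?_⟩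
    rcases Nat.eq_zero_or_pos m with rfl | hm0
    · simp only [pow_zero, one_apply_eq_self, add_apply]
      linarith [apply_nonneg q x]
    · have := hT (F r ^ m) ⟨m, 1, r, hm0, one_pos, hr, by simpa using Or.inl hm, by simp⟩ x
      rw [hqx] at this
      simp only [add_apply]
      linarith [apply_nonneg (p i) x]
  intro q hq s
  obtain ⟨A, C, -, hle⟩ := Seminorm.bound_of_continuous hp q hq
  choose q' hq' hb using fun i => key i s
  obtain ⟨Q, hQ, hQx⟩ := exists_seminorm_eq_sum hq' A (fun _ => (C : ℝ)) fun _ _ => C.2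
  refine ⟨Q, hQ, fun r hr m hm x => (hle _).trans ?_⟩
  rw [← hQx, ← Finset.mul_sum, smul_apply, NNReal.smul_def, smul_eq_mul]
  refine mul_le_mul_of_nonneg_left ?_ C.2
  refine Seminorm.finset_sup_apply_le (Finset.sum_nonneg fun i _ => apply_nonneg _ _)
    fun i hi => (hb i r hr m hm x).trans ?_
  exact Finset.single_le_sum (f := fun i => q' i x) (fun i _ => apply_nonneg _ _) hi

theorem tendsto_iff_seminorm [IsTopologicalAddGroup X] [ContinuousSMul 𝕜 X]
    {p : SeminormFamily 𝕜 X ι} (hp : WithSeminorms p) {α : Type*}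
    {u : α → X} {l : Filter α} {y : X} :
    Tendsto u l (𝓝 y) ↔
      ∀ q : Seminorm 𝕜 X, Continuous q → ∀ ε : ℝ, 0 < ε → ∀ᶠ a in l, q (u a - y) < ε := by
  constructor
  · intro h q hq ε hε
    have h1 : Tendsto (fun a => q (u a - y)) l (𝓝 (q (y - y))) :=
      (hq.tendsto _).comp (h.sub_const y)
    rw [sub_self, map_zero] at h1
    exact h1.eventually_lt_const hε
  · intro h
    rw [hp.tendsto_nhds]
    exact fun i ε hε => h (p i) (hp.continuous_seminorm i) ε hε

theorem eq_zero_of_forall_seminorm [T2Space X] {p : SeminormFamily 𝕜 X ι}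
    (hp : WithSeminorms p) {x : X} (h : ∀ q : Seminorm 𝕜 X, Continuous q → q x = 0) :
    x = 0 := by
  by_contra hx
  obtain ⟨i, hi⟩ := hp.separating_of_T1 x hx
  have := hp.topologicalAddGroup
  have := hp.continuousSMul
  exact hi (h (p i) (hp.continuous_seminorm i))

end Basic

section Seminorm

variable {𝕜 X : Type*} [RCLike 𝕜] [AddCommGroup X] [Module 𝕜 X]

theorem seminorm_smul_ofReal (q : Seminorm 𝕜 X) {r : ℝ} (hr : 0 ≤ r) (x : X) :
    q ((r : 𝕜) • x) = r * q x := by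
  rw [map_smul_eq_mul, RCLike.norm_ofReal, abs_of_nonneg hr]

theorem seminorm_add_le (q : Seminorm 𝕜 X) {x y : X} {a b : ℝ} (hx : q x ≤ a) (hy : q y ≤ b) :
    q (x + y) ≤ a + b :=
  (map_add_le_add q x y).trans (add_le_add hx hy)

theorem seminorm_sub_le (q : Seminorm 𝕜 X) {x y : X} {a b : ℝ} (hx : q x ≤ a) (hy : q y ≤ b) :
    q (x - y) ≤ a + b :=
  (map_sub_le_add q x y).trans (add_le_add hx hy)

theorem seminorm_smul_sum_le (q : Seminorm 𝕜 X) {h C : ℝ} (hh : 0 ≤ h) (m : ℕ) (v : ℕ → X)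
    (hv : ∀ k < m, q (v k) ≤ C) :
    q ((h : 𝕜) • ∑ k ∈ Finset.range m, v k) ≤ (m : ℝ) * h * C := by
  rw [seminorm_smul_ofReal q hh]
  have : q (∑ k ∈ Finset.range m, v k) ≤ m * C := by
    refine (Finset.le_sum_of_subadditive q (map_zero q).le (map_add_le_add q) _ _).trans ?_
    refine (Finset.sum_le_card_nsmul _ _ C fun k hk => hv k (Finset.mem_range.1 hk)).trans ?_
    rw [Finset.card_range, nsmul_eq_mul]
  nlinarith

theorem pow_sub_eq_sum [TopologicalSpace X] (T : X →L[𝕜] X) (m : ℕ) (x : X) :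
    (T ^ m) x - x = ∑ k ∈ Finset.range m, (T ^ k) (T x - x) := by
  have := Finset.sum_range_sub (fun k => (T ^ k) x) m
  simp only [pow_zero, one_apply_eq_self] at this
  rw [← this]
  refine Finset.sum_congr rfl fun k _ => ?_
  rw [map_sub, pow_succ, mul_apply_eq_comp]

end Seminorm

/-! ### The asymptotic graph and single-valuedness of the effective derivative -/

section Asymptotic

variable {𝕜 X ι : Type*} [RCLike 𝕜] [AddCommGroup X] [Module 𝕜 X] [TopologicalSpace X]

/-- The pairs `(x, y)` for which `F(h)^m x - x - h ∑_{k < m} F(h)^k y` tends to `0` as `h → 0+`,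
uniformly over the `m` with `m h` bounded: the discrete form of `T(t) x - x = ∫₀ᵗ T(s) y ds`. -/
def asympGraph (F : ℝ → X →L[𝕜] X) : Set (X × X) :=
  {z | ∀ q : Seminorm 𝕜 X, Continuous q → ∀ s : ℝ, ∀ η : ℝ, 0 < η → ∀ᶠ h : ℝ in 𝓝[>] 0,
    ∀ m : ℕ, (m : ℝ) * h ≤ s →
      q ((F h ^ m) z.1 - z.1 - (h : 𝕜) • ∑ k ∈ Finset.range m, (F h ^ k) z.2) ≤ η}

theorem nat_mul_le_of_lt {k m : ℕ} {h s : ℝ} (hh : 0 ≤ h) (hm : (m : ℝ) * h ≤ s) (hk : k < m) :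
    (k : ℝ) * h ≤ s :=
  le_trans (mul_le_mul_of_nonneg_right (by exact_mod_cast hk.le) hh) hm

theorem effGraph_subset_asympGraph [IsTopologicalAddGroup X] [ContinuousSMul 𝕜 X]
    {p : SeminormFamily 𝕜 X ι} (hp : WithSeminorms p) {F : ℝ → X →L[𝕜] X}
    (hF0 : F 0 = ContinuousLinearMap.id 𝕜 X) (hE : EquicontinuousPowers F) :
    (effGraph F : Set (X × X)) ⊆ asympGraph F := by
  rintro ⟨x, y⟩ ⟨u, hu, hu'⟩ q hq s η hη
  dsimp only at hu hu' ⊢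
  obtain ⟨q', hq', hb⟩ := hE q hq s
  have hε : 0 < η / (2 + |s|) := by positivity
  set ε := η / (2 + |s|) with hεdef
  filter_upwards [(tendsto_iff_seminorm hp).1 hu q hq ε hε,
    (tendsto_iff_seminorm hp).1 hu q' hq' ε hε,
    (tendsto_iff_seminorm hp).1 hu' q' hq' ε hε, self_mem_nhdsWithin] with h h1 h2 h3 h4 m hm
  have h4 : 0 < h := h4
  set z := ((h : 𝕜))⁻¹ • (F h - F 0) (u h) with hz
  have hzu : F h (u h) - u h = (h : 𝕜) • z := by
    have : (h : 𝕜) ≠ 0 := by exact_mod_cast h4.ne'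
    rw [hz, smul_inv_smul₀ this, hF0]
    rfl
  have e1 : (F h ^ m) x - x - (h : 𝕜) • ∑ k ∈ Finset.range m, (F h ^ k) y
      = ((u h - x) - (F h ^ m) (u h - x))
        + (h : 𝕜) • ∑ k ∈ Finset.range m, (F h ^ k) (z - y) := by
    have := pow_sub_eq_sum (F h) m (u h)
    rw [hzu] at this
    simp only [map_smul, ← Finset.smul_sum] at this
    simp only [map_sub, Finset.sum_sub_distrib, smul_sub, ← this]
    abel
  have hm0 : (0 : ℝ) ≤ m * h := by positivity
  have hms : (m : ℝ) * h ≤ |s| := hm.trans (le_abs_self s)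
  rw [e1]
  have b1 := seminorm_sub_le q h1.le ((hb h h4.le m hm (u h - x)).trans h2.le)
  have b2 := seminorm_smul_sum_le (𝕜 := 𝕜) q h4.le m (fun k => (F h ^ k) (z - y))
    fun k hk => (hb h h4.le k (nat_mul_le_of_lt h4.le hm hk) (z - y)).trans h3.le
  refine (seminorm_add_le q b1 b2).trans ?_
  have : ε * (2 + |s|) = η := by rw [hεdef]; field_simp
  nlinarith

theorem mem_asympGraph_of_mem_closure [IsTopologicalAddGroup X] [ContinuousSMul 𝕜 X]
    {F : ℝ → X →L[𝕜] X} (hE : EquicontinuousPowers F) {z : X × X}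
    (hz : z ∈ closure (asympGraph F)) : z ∈ asympGraph F := by
  intro q hq s η hη
  obtain ⟨q', hq', hb⟩ := hE q hq s
  have hε : 0 < η / (3 + |s|) := by positivity
  set ε := η / (3 + |s|) with hεdef
  have hcont : Continuous fun w : X × X => q (z.1 - w.1) + q' (z.1 - w.1) + q' (z.2 - w.2) := by
    fun_prop
  have hnhds : {w : X × X | q (z.1 - w.1) + q' (z.1 - w.1) + q' (z.2 - w.2) < ε} ∈ 𝓝 z := by
    refine (isOpen_lt hcont continuous_const).mem_nhds ?_
    simpa using hε
  obtain ⟨w, hw, hwG⟩ := mem_closure_iff_nhds.1 hz _ hnhds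
  have hw : q (z.1 - w.1) + q' (z.1 - w.1) + q' (z.2 - w.2) < ε := hw
  have n1 := apply_nonneg q (z.1 - w.1)
  have n2 := apply_nonneg q' (z.1 - w.1)
  have n3 := apply_nonneg q' (z.2 - w.2)
  filter_upwards [hwG q hq s ε hε, self_mem_nhdsWithin] with h h1 h4 m hm
  have h4 : 0 < h := h4
  have e1 : (F h ^ m) z.1 - z.1 - (h : 𝕜) • ∑ k ∈ Finset.range m, (F h ^ k) z.2
      = ((F h ^ m) w.1 - w.1 - (h : 𝕜) • ∑ k ∈ Finset.range m, (F h ^ k) w.2)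
        + ((F h ^ m) (z.1 - w.1) - (z.1 - w.1))
        - (h : 𝕜) • ∑ k ∈ Finset.range m, (F h ^ k) (z.2 - w.2) := by
    simp only [map_sub, Finset.sum_sub_distrib, smul_sub]
    abel
  rw [e1]
  have b1 := seminorm_sub_le q (hb h h4.le m hm (z.1 - w.1)) (le_refl (q (z.1 - w.1)))
  have b2 := seminorm_smul_sum_le (𝕜 := 𝕜) q h4.le m (fun k => (F h ^ k) (z.2 - w.2))
    fun k hk => hb h h4.le k (nat_mul_le_of_lt h4.le hm hk) (z.2 - w.2)
  refine (seminorm_sub_le q (seminorm_add_le q (h1 m hm) b1) b2).trans ?_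
  have hm0 : (0 : ℝ) ≤ m * h := by positivity
  have hms : (m : ℝ) * h ≤ |s| := hm.trans (le_abs_self s)
  have : ε * (3 + |s|) = η := by rw [hεdef]; field_simp
  nlinarith [abs_nonneg s]

/-- Strong continuity at zero of the powers, uniformly in the step size. -/
theorem eventually_pow_sub_le [IsTopologicalAddGroup X] [ContinuousSMul 𝕜 X]
    {F : ℝ → X →L[𝕜] X} (hE : EquicontinuousPowers F)
    (hd : Dense {x : X | ∃ y : X, (x, y) ∈ asympGraph F})
    {q : Seminorm 𝕜 X} (hq : Continuous q) (x : X) {ε : ℝ} (hε : 0 < ε) :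
    ∃ τ : ℝ, 0 < τ ∧ ∀ᶠ h : ℝ in 𝓝[>] 0, ∀ m : ℕ, (m : ℝ) * h ≤ τ →
      q ((F h ^ m) x - x) ≤ ε := by
  obtain ⟨q', hq', hb⟩ := hE q hq 1
  have hcont : Continuous fun w : X => q (x - w) + q' (x - w) := by fun_prop
  have hnhds : {w : X | q (x - w) + q' (x - w) < ε / 3} ∈ 𝓝 x := by
    refine (isOpen_lt hcont continuous_const).mem_nhds ?_
    simpa using hε
  obtain ⟨w, hw, y, hwy⟩ := mem_closure_iff_nhds.1 (hd x) _ hnhds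
  have hw : q (x - w) + q' (x - w) < ε / 3 := hw
  have n3 := apply_nonneg q' y
  have hy : 0 < 1 + q' y := by positivity
  refine ⟨min 1 (ε / (3 * (1 + q' y))), by positivity, ?_⟩
  filter_upwards [hwy q hq 1 (ε / 3) (by positivity), self_mem_nhdsWithin] with h h1 h4 m hm
  have h4 : 0 < h := h4
  have hm1 := hm.trans (min_le_left _ _)
  have hm2 := hm.trans (min_le_right _ _)
  have e1 : (F h ^ m) x - x
      = ((F h ^ m) w - w - (h : 𝕜) • ∑ k ∈ Finset.range m, (F h ^ k) y)
        + ((F h ^ m) (x - w) - (x - w))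
        + (h : 𝕜) • ∑ k ∈ Finset.range m, (F h ^ k) y := by
    simp only [map_sub]
    abel
  rw [e1]
  have b1 := seminorm_sub_le q (hb h h4.le m hm1 (x - w)) (le_refl (q (x - w)))
  have b2 := seminorm_smul_sum_le (𝕜 := 𝕜) q h4.le m (fun k => (F h ^ k) y)
    fun k hk => hb h h4.le k (nat_mul_le_of_lt h4.le hm1 hk) y
  refine (seminorm_add_le q (seminorm_add_le q (h1 m hm1) b1) b2).trans ?_
  have hm0 : (0 : ℝ) ≤ m * h := by positivity
  rw [le_div_iff₀ (by positivity)] at hm2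
  nlinarith

/-- If `y` moves little under the powers `F(h)^m`, `m h ≤ τ`, then the discrete integral in
`asympGraph` can be replaced by `m h y`. -/
theorem eventually_pow_sub_sub_le {F : ℝ → X →L[𝕜] X} {x y : X} (hxy : (x, y) ∈ asympGraph F)
    {q : Seminorm 𝕜 X} (hq : Continuous q) {𝓕 : Filter ℝ} (h𝓕 : 𝓕 ≤ 𝓝[>] 0) {τ ε : ℝ}
    (hy : ∀ᶠ h : ℝ in 𝓕, ∀ m : ℕ, (m : ℝ) * h ≤ τ → q ((F h ^ m) y - y) ≤ ε)
    {η : ℝ} (hη : 0 < η) :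
    ∀ᶠ h : ℝ in 𝓕, ∀ m : ℕ, (m : ℝ) * h ≤ τ →
      q ((F h ^ m) x - x - ((m * h : ℝ) : 𝕜) • y) ≤ m * h * ε + η := by
  filter_upwards [hy, h𝓕 (hxy q hq τ η hη), h𝓕 self_mem_nhdsWithin] with h h1 h2 h4 m hm
  have h4 : 0 < h := h4
  have e1 : (F h ^ m) x - x - ((m * h : ℝ) : 𝕜) • y
      = (h : 𝕜) • (∑ k ∈ Finset.range m, ((F h ^ k) y - y))
        + ((F h ^ m) x - x - (h : 𝕜) • ∑ k ∈ Finset.range m, (F h ^ k) y) := by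
    rw [Finset.sum_sub_distrib, Finset.sum_const, Finset.card_range, smul_sub,
      ← Nat.cast_smul_eq_nsmul 𝕜, smul_smul]
    push_cast
    rw [mul_comm (h : 𝕜)]
    abel
  rw [e1]
  exact seminorm_add_le q (seminorm_smul_sum_le q h4.le m _
    fun k hk => h1 k (nat_mul_le_of_lt h4.le hm hk)) (h2 m hm)

end Asymptotic

section SingleValued

variable {𝕜 X ι : Type*} [RCLike 𝕜] [AddCommGroup X] [Module 𝕜 X] [TopologicalSpace X]

theorem floor_div_mul_le {τ h : ℝ} (hτ : 0 ≤ τ) (hh : 0 < h) : (⌊τ / h⌋₊ : ℝ) * h ≤ τ := by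
  have := Nat.floor_le (div_nonneg hτ hh.le)
  rwa [le_div_iff₀ hh] at this

theorem lt_floor_div_mul_add (τ : ℝ) {h : ℝ} (hh : 0 < h) :
    τ < (⌊τ / h⌋₊ : ℝ) * h + h := by
  have := Nat.lt_floor_add_one (τ / h)
  rw [div_lt_iff₀ hh] at this
  linarith

theorem eventually_Ioo_nhdsGT {c : ℝ} (hc : 0 < c) : ∀ᶠ h : ℝ in 𝓝[>] 0, 0 < h ∧ h < c :=
  Ioo_mem_nhdsGT hc

theorem asympGraph_snd_eq_zero [T2Space X] {p : SeminormFamily 𝕜 X ι} (hp : WithSeminorms p)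
    {F : ℝ → X →L[𝕜] X} (hE : EquicontinuousPowers F)
    (hd : Dense {x : X | ∃ y : X, (x, y) ∈ asympGraph F})
    {y : X} (hy : ((0 : X), y) ∈ asympGraph F) : y = 0 := by
  have := hp.topologicalAddGroup
  have := hp.continuousSMul
  refine eq_zero_of_forall_seminorm hp fun q hq => le_antisymm ?_ (apply_nonneg q y)
  refine le_of_forall_pos_le_add fun ε hε => ?_
  obtain ⟨τ, hτ, h1⟩ := eventually_pow_sub_le hE hd hq y (half_pos hε)
  have hη : 0 < ε * τ / 4 := by positivity
  obtain ⟨h, h2, h0, hhτ⟩ := ((eventually_pow_sub_sub_le hy hq le_rfl h1 hη).and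
    (eventually_Ioo_nhdsGT (half_pos hτ))).exists
  have l1 := floor_div_mul_le hτ.le h0
  have l2 := lt_floor_div_mul_add τ h0
  have h3 := h2 _ l1
  set c := (⌊τ / h⌋₊ : ℝ) * h
  rw [map_zero, sub_zero, zero_sub, map_neg_eq_map, seminorm_smul_ofReal q (by linarith)] at h3
  have hc : τ / 2 < c := by linarith
  have : c * q y ≤ c * ε := by nlinarith
  rw [zero_add]
  exact le_of_mul_le_mul_left this (by linarith)

/-- An operator contained in the effective derivative is closable, and the graph of its closure
stays in the asymptotic graph. -/
theorem isClosable_of_le_effDeriv [IsTopologicalAddGroup X] [ContinuousSMul 𝕜 X] [T2Space X]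
    {p : SeminormFamily 𝕜 X ι} (hp : WithSeminorms p) {F : ℝ → X →L[𝕜] X} (hF : ClassF p F)
    {Z : X →ₗ.[𝕜] X} (hZF : Z ≤ effDeriv F) :
    Z.IsClosable ∧ (Z.closure.graph : Set (X × X)) ⊆ asympGraph F ∧
      Dense {x : X | ∃ y : X, (x, y) ∈ asympGraph F} := by
  have hE := hF.toClassE.equicontinuousPowers hp
  have hsub := effGraph_subset_asympGraph hp hF.map_zero hE
  have hd : Dense {x : X | ∃ y : X, (x, y) ∈ asympGraph F} :=
    Dense.mono (fun _ hx => hx.imp fun _ hy => hsub hy) hF.dense_domain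
  have hzero : ∀ z ∈ asympGraph F, z.1 = 0 → z.2 = 0 := by
    rintro ⟨x, y⟩ hz rfl
    exact asympGraph_snd_eq_zero hp hE hd hz
  have hgraph : (effDeriv F).graph = effGraph F :=
    Submodule.toLinearPMap_graph_eq _ fun z hz => hzero z (hsub hz)
  have hcl : (Z.graph.topologicalClosure : Set (X × X)) ⊆ asympGraph F := by
    intro z hz
    refine mem_asympGraph_of_mem_closure hE (closure_mono (fun w hw => hsub ?_) hz)
    exact hgraph.le (LinearPMap.le_graph_of_le hZF hw)
  have hclos : Z.IsClosable :=
    ⟨Z.graph.topologicalClosure.toLinearPMap,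
      (Submodule.toLinearPMap_graph_eq _ fun z hz => hzero z (hcl hz)).symm⟩
  refine ⟨hclos, ?_, hd⟩
  rw [← hclos.graph_closure_eq_closure_graph]
  exact hcl

end SingleValued

/-! ### Convergence of the powers along a local solution -/

section Solution

variable {𝕜 X ι : Type*} [RCLike 𝕜] [AddCommGroup X] [Module 𝕜 X] [TopologicalSpace X]
  [IsTopologicalAddGroup X] [ContinuousSMul 𝕜 X]

/-- The derivative within `[0, l)` as a first-order expansion in every continuous seminorm. -/
theorem tendsto_slope_Ico_iff {p : SeminormFamily 𝕜 X ι} (hp : WithSeminorms p)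
    {f : ℝ → X} {l s : ℝ} {y : X} :
    Tendsto (fun v : ℝ => (((v - s : ℝ) : 𝕜))⁻¹ • (f v - f s)) (𝓝[Set.Ico 0 l \ {s}] s) (𝓝 y) ↔
      ∀ q : Seminorm 𝕜 X, Continuous q → ∀ ε : ℝ, 0 < ε → ∃ δ : ℝ, 0 < δ ∧
        ∀ v ∈ Set.Ico 0 l, |v - s| < δ →
          q (f v - f s - ((v - s : ℝ) : 𝕜) • y) ≤ ε * |v - s| := by
  have key : ∀ (q : Seminorm 𝕜 X) (v : ℝ), v ≠ s →
      q (f v - f s - ((v - s : ℝ) : 𝕜) • y)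
        = |v - s| * q ((((v - s : ℝ) : 𝕜))⁻¹ • (f v - f s) - y) := by
    intro q v hv
    have hne : ((v - s : ℝ) : 𝕜) ≠ 0 := by
      rw [Ne, RCLike.ofReal_eq_zero, sub_eq_zero]
      exact hv
    rw [← RCLike.norm_ofReal (K := 𝕜), ← map_smul_eq_mul, smul_sub, smul_inv_smul₀ hne]
  rw [tendsto_iff_seminorm hp]
  constructor
  · intro h q hq ε hε
    obtain ⟨δ, hδ, hb⟩ := Metric.eventually_nhds_iff.1 (eventually_nhdsWithin_iff.1 (h q hq ε hε))
    refine ⟨δ, hδ, fun v hv hvδ => ?_⟩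
    rcases eq_or_ne v s with rfl | hvs
    · simp
    · have := hb (y := v) hvδ ⟨hv, hvs⟩
      rw [key q v hvs, mul_comm ε]
      exact mul_le_mul_of_nonneg_left this.le (abs_nonneg _)
  · intro h q hq ε hε
    obtain ⟨δ, hδ, hb⟩ := h q hq (ε / 2) (half_pos hε)
    refine eventually_nhdsWithin_iff.2 (Metric.eventually_nhds_iff.2 ⟨δ, hδ, fun v hvδ hv => ?_⟩)
    have hvs : v ≠ s := hv.2
    have := hb v hv.1 hvδ
    rw [key q v hvs, mul_comm (ε / 2)] at this
    have := le_of_mul_le_mul_left this (abs_pos.2 (sub_ne_zero.2 hvs))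
    linarith

/-- One step of the telescoping estimate: across a short interval `[a, b]` tagged by `ξ`, the powers
of `F` follow `f` with an error proportional to the length. -/
theorem eventually_pow_sub_le_of_tag {F : ℝ → X →L[𝕜] X} (hE : EquicontinuousPowers F)
    (hd : Dense {x : X | ∃ y : X, (x, y) ∈ asympGraph F}) {f : ℝ → X} {l ξ : ℝ} {y : X}
    (hy : (f ξ, y) ∈ asympGraph F)
    (hf : ∀ q : Seminorm 𝕜 X, Continuous q → ∀ ε : ℝ, 0 < ε → ∃ δ : ℝ, 0 < δ ∧
        ∀ v ∈ Set.Ico 0 l, |v - ξ| < δ →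
          q (f v - f ξ - ((v - ξ : ℝ) : 𝕜) • y) ≤ ε * |v - ξ|)
    {q : Seminorm 𝕜 X} (hq : Continuous q) {ε : ℝ} (hε : 0 < ε) :
    ∃ δ : ℝ, 0 < δ ∧ ∀ a ∈ Set.Ico 0 l, ∀ b ∈ Set.Ico 0 l, a ≤ ξ → ξ ≤ b → b - a < δ →
      ∀ᶠ h : ℝ in 𝓝[>] 0,
        q ((F h ^ (⌊b / h⌋₊ - ⌊a / h⌋₊)) (f a) - f b) ≤ ε * (b - a) := by
  obtain ⟨q', hq', hb'⟩ := hE q hq 1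
  have hε1 : 0 < ε / 7 := by positivity
  -- The total error is at most `7 e (b - a)`: `m h ≤ 2 (b - a)`, and five more errors `e (b - a)`.
  set e := ε / 7 with he
  obtain ⟨τ, hτ, hev⟩ := eventually_pow_sub_le hE hd hq y hε1
  obtain ⟨δ₁, hδ₁, hf1⟩ := hf q hq e hε1
  obtain ⟨δ₂, hδ₂, hf2⟩ := hf q' hq' e hε1
  refine ⟨min (min τ 1) (min δ₁ δ₂), by positivity, fun a ha b hb haξ hξb hab => ?_⟩
  rcases eq_or_lt_of_le (haξ.trans hξb) with rfl | hlt
  · obtain rfl : a = ξ := le_antisymm haξ hξb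
    simp
  have hba : 0 < b - a := sub_pos.2 hlt
  have hτ' : b - a < τ := hab.trans_le ((min_le_left _ _).trans (min_le_left _ _))
  have h1' : b - a < 1 := hab.trans_le ((min_le_left _ _).trans (min_le_right _ _))
  have hδ₁' : b - a < δ₁ := hab.trans_le ((min_le_right _ _).trans (min_le_left _ _))
  have hδ₂' : b - a < δ₂ := hab.trans_le ((min_le_right _ _).trans (min_le_right _ _))
  -- Expand both `f a` and `f b` at the tag `ξ`.
  set ra := f a - f ξ - ((a - ξ : ℝ) : 𝕜) • y with hra
  set rb := f b - f ξ - ((b - ξ : ℝ) : 𝕜) • y with hrb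
  have ra_le : q' ra ≤ e * (b - a) := by
    have h0 : |a - ξ| ≤ b - a := by rw [abs_le]; constructor <;> linarith
    exact (hf2 a ha (h0.trans_lt hδ₂')).trans (mul_le_mul_of_nonneg_left h0 hε1.le)
  have rb_le : q rb ≤ e * (b - a) := by
    have h0 : |b - ξ| ≤ b - a := by rw [abs_le]; constructor <;> linarith
    exact (hf1 b hb (h0.trans_lt hδ₁')).trans (mul_le_mul_of_nonneg_left h0 hε1.le)
  have hqy : 0 < 1 + q y := by have := apply_nonneg q y; positivity
  have hη : 0 < e * (b - a) := by positivity
  filter_upwards [hev, eventually_pow_sub_sub_le hy hq le_rfl hev hη,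
    eventually_Ioo_nhdsGT (sub_pos.2 hτ'), eventually_Ioo_nhdsGT (sub_pos.2 h1'),
    eventually_Ioo_nhdsGT hba,
    eventually_Ioo_nhdsGT (div_pos hη hqy)] with h g1 g2 ⟨h0, g3⟩ ⟨_, g4⟩ ⟨_, g5⟩ ⟨_, g6⟩
  -- The number of steps across `[a, b]`: `m h` differs from `b - a` by at most `h`.
  have fle : ⌊a / h⌋₊ ≤ ⌊b / h⌋₊ := Nat.floor_le_floor (div_le_div_of_nonneg_right hlt.le h0.le)
  set m := ⌊b / h⌋₊ - ⌊a / h⌋₊ with hm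
  have hmc : (m : ℝ) * h = ⌊b / h⌋₊ * h - ⌊a / h⌋₊ * h := by
    rw [hm, Nat.cast_sub fle, sub_mul]
  have u1 := floor_div_mul_le ha.1 h0
  have u2 := floor_div_mul_le hb.1 h0
  have u3 := lt_floor_div_mul_add a h0
  have u4 := lt_floor_div_mul_add b h0
  have hmτ : (m : ℝ) * h ≤ τ := by linarith
  have hm1 : (m : ℝ) * h ≤ 1 := by linarith
  have e1 : (F h ^ m) (f a) - f b
      = (((F h ^ m) (f ξ) - f ξ - ((m * h : ℝ) : 𝕜) • y)
        - ((ξ - a : ℝ) : 𝕜) • ((F h ^ m) y - y))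
        + (((m * h - (b - a) : ℝ)) : 𝕜) • y + ((F h ^ m) ra - rb) := by
    rw [hra, hrb]
    simp only [map_sub, map_smul]
    push_cast
    module
  have b1 := g2 m hmτ
  have b2 : q (((ξ - a : ℝ) : 𝕜) • ((F h ^ m) y - y)) ≤ (ξ - a) * e := by
    rw [seminorm_smul_ofReal q (by linarith)]
    exact mul_le_mul_of_nonneg_left (g1 m hmτ) (by linarith)
  have b3 : q ((((m * h - (b - a) : ℝ)) : 𝕜) • y) ≤ e * (b - a) := by
    rw [map_smul_eq_mul, RCLike.norm_ofReal]
    have : |(m : ℝ) * h - (b - a)| ≤ h := by rw [abs_le]; constructor <;> linarith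
    rw [lt_div_iff₀ hqy] at g6
    have := mul_le_mul_of_nonneg_right this (apply_nonneg q y)
    nlinarith
  have b4 := seminorm_sub_le q ((hb' h h0.le m hm1 ra).trans ra_le) rb_le
  rw [e1]
  refine (seminorm_add_le q (seminorm_add_le q (seminorm_sub_le q b1 b2) b3) b4).trans ?_
  have : ε = 7 * e := by rw [he]; ring
  rw [this]
  nlinarith

/-- Along a local solution of an equation whose operator has its graph in `asympGraph F`, the powers
`F(h)^[v/h]` converge to the solution.  The derivative need not be continuous, so the telescoping
uses a partition adapted to the solution, built by a supremum argument. -/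
theorem IsLocalSolution.tendsto_pow {p : SeminormFamily 𝕜 X ι} (hp : WithSeminorms p)
    {F : ℝ → X →L[𝕜] X} (hE : EquicontinuousPowers F)
    (hd : Dense {x : X | ∃ y : X, (x, y) ∈ asympGraph F}) {A : X →ₗ.[𝕜] X}
    (hA : (A.graph : Set (X × X)) ⊆ asympGraph F) {l : ℝ} {x : X} {f : ℝ → X}
    (hf : IsLocalSolution A l x f) {s : ℝ} (hs : s ∈ Set.Ico 0 l) :
    Tendsto (fun h : ℝ => (F h ^ ⌊s / h⌋₊) x) (𝓝[>] 0) (𝓝 (f s)) := by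
  rw [tendsto_iff_seminorm hp]
  intro q hq ε' hε'
  obtain ⟨ε, hε, hεs⟩ : ∃ ε : ℝ, 0 < ε ∧ ε * s < ε' := by
    have h1 : 0 < s + 1 := by linarith [hs.1]
    refine ⟨ε' / (s + 1), by positivity, ?_⟩
    rw [div_mul_eq_mul_div, div_lt_iff₀ h1]
    linarith
  obtain ⟨q', hq', hb'⟩ := hE q hq s
  -- Errors are measured after applying the remaining powers, so that they add up along the way.
  let P : ℝ → Prop := fun v => ∀ᶠ h : ℝ in 𝓝[>] 0, ∀ k : ℕ, k + ⌊v / h⌋₊ ≤ ⌊s / h⌋₊ →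
    q ((F h ^ k) ((F h ^ ⌊v / h⌋₊) x - f v)) ≤ ε * v
  have hP0 : P 0 := by
    filter_upwards with h k hk
    simp [hf.init]
  have step : ∀ ξ ∈ Set.Ico 0 l, ∃ δ : ℝ, 0 < δ ∧ ∀ a ∈ Set.Ico 0 l, ∀ b ∈ Set.Ico 0 l,
      a ≤ ξ → ξ ≤ b → b - a < δ → P a → P b := by
    intro ξ hξ
    obtain ⟨hdom, hder⟩ := hf.deriv ξ hξ
    obtain ⟨δ, hδ, hloc⟩ := eventually_pow_sub_le_of_tag hE hd (hA (A.mem_graph ⟨f ξ, hdom⟩))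
      ((tendsto_slope_Ico_iff hp).1 hder) hq' hε
    refine ⟨δ, hδ, fun a ha b hb haξ hξb hab hPa => ?_⟩
    filter_upwards [hloc a ha b hb haξ hξb hab, hPa, self_mem_nhdsWithin] with h g1 g2 h0 k hk
    have h0 : 0 < h := h0
    have fle : ⌊a / h⌋₊ ≤ ⌊b / h⌋₊ :=
      Nat.floor_le_floor (div_le_div_of_nonneg_right (haξ.trans hξb) h0.le)
    have hks : (k : ℝ) * h ≤ s := by
      refine le_trans ?_ (floor_div_mul_le hs.1 h0)
      refine mul_le_mul_of_nonneg_right ?_ h0.le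
      exact_mod_cast (Nat.le_add_right _ _).trans hk
    have e1 : (F h ^ k) ((F h ^ ⌊b / h⌋₊) x - f b)
        = (F h ^ (k + (⌊b / h⌋₊ - ⌊a / h⌋₊))) ((F h ^ ⌊a / h⌋₊) x - f a)
          + (F h ^ k) ((F h ^ (⌊b / h⌋₊ - ⌊a / h⌋₊)) (f a) - f b) := by
      have : F h ^ ⌊b / h⌋₊ = F h ^ (⌊b / h⌋₊ - ⌊a / h⌋₊) * F h ^ ⌊a / h⌋₊ := by
        rw [← pow_add, Nat.sub_add_cancel fle]
      rw [this, pow_add]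
      simp only [mul_apply_eq_comp, map_sub]
      abel
    rw [e1]
    refine (seminorm_add_le q (g2 _ (by omega)) ((hb' h h0.le k hks _).trans g1)).trans ?_
    linarith
  let S : Set ℝ := {v | 0 ≤ v ∧ v ≤ s ∧ P v}
  have hSne : S.Nonempty := ⟨0, le_rfl, hs.1, hP0⟩
  have hSbd : BddAbove S := ⟨s, fun v hv => hv.2.1⟩
  have hξ0 : 0 ≤ sSup S := le_csSup hSbd ⟨le_rfl, hs.1, hP0⟩
  have hξs : sSup S ≤ s := csSup_le hSne fun v hv => hv.2.1
  set ξ := sSup S with hξ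
  have hξl : ξ ∈ Set.Ico 0 l := ⟨hξ0, hξs.trans_lt hs.2⟩
  obtain ⟨δ, hδ, hstep⟩ := step ξ hξl
  have hPξ : P ξ := by
    obtain ⟨a, haS, ha⟩ := exists_lt_of_lt_csSup hSne (sub_lt_self ξ hδ)
    exact hstep a ⟨haS.1, haS.2.1.trans_lt hs.2⟩ ξ hξl (le_csSup hSbd haS) le_rfl
      (by linarith) haS.2.2
  have hPs : P s := by
    rcases eq_or_lt_of_le hξs with heq | hlt
    · rwa [← heq]
    · exfalso
      have hb1 : ξ < min s (ξ + δ / 2) := lt_min hlt (by linarith)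
      have hb2 : min s (ξ + δ / 2) ≤ s := min_le_left _ _
      have hb3 : min s (ξ + δ / 2) ≤ ξ + δ / 2 := min_le_right _ _
      set b := min s (ξ + δ / 2)
      have hPb := hstep ξ hξl b ⟨by linarith, hb2.trans_lt hs.2⟩ le_rfl hb1.le
        (by linarith) hPξ
      exact absurd (le_csSup hSbd (a := b) ⟨by linarith, hb2, hPb⟩) (not_le.2 hb1)
  filter_upwards [hPs] with h hh
  have := hh 0 (by simp)
  simp only [pow_zero, one_apply_eq_self] at this
  linarith

end Solution

/-! ### Limits of powers along a filter of step sizes -/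

section PowTendsto

variable {𝕜 X ι : Type*} [RCLike 𝕜] [AddCommGroup X] [Module 𝕜 X] [TopologicalSpace X]

/-- `F(h)^{m(h)} x → y` along the filter `𝓕` of step sizes whenever `m(h) h → v`.  Allowing every
choice of the exponents `m` makes the relation compatible with addition of times. -/
def PowTendsto (F : ℝ → X →L[𝕜] X) (𝓕 : Filter ℝ) (x : X) (v : ℝ) (y : X) : Prop :=
  ∀ m : ℝ → ℕ, Tendsto (fun h => (m h : ℝ) * h) 𝓕 (𝓝 v) →
    Tendsto (fun h => (F h ^ m h) x) 𝓕 (𝓝 y)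

theorem tendsto_floor_div_mul {𝓕 : Filter ℝ} (h𝓕 : 𝓕 ≤ 𝓝[>] 0) {v : ℝ} (hv : 0 ≤ v) :
    Tendsto (fun h => (⌊v / h⌋₊ : ℝ) * h) 𝓕 (𝓝 v) := by
  have h1 : Tendsto (fun h : ℝ => v - h) 𝓕 (𝓝 (v - 0)) :=
    tendsto_const_nhds.sub (tendsto_id'.2 (h𝓕.trans nhdsWithin_le_nhds))
  rw [sub_zero] at h1
  refine tendsto_of_tendsto_of_tendsto_of_le_of_le' h1 tendsto_const_nhds ?_ ?_
  · filter_upwards [h𝓕 self_mem_nhdsWithin] with h hh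
    linarith [lt_floor_div_mul_add v hh]
  · filter_upwards [h𝓕 self_mem_nhdsWithin] with h hh
    exact floor_div_mul_le hv hh

variable [IsTopologicalAddGroup X] [ContinuousSMul 𝕜 X] {p : SeminormFamily 𝕜 X ι}
  {F : ℝ → X →L[𝕜] X} {𝓕 : Filter ℝ}

/-- Powers with nearby exponents are close, uniformly in the step size. -/
theorem eventually_pow_sub_pow_le (hE : EquicontinuousPowers F)
    (hd : Dense {x : X | ∃ y : X, (x, y) ∈ asympGraph F})
    {q : Seminorm 𝕜 X} (hq : Continuous q) (x : X) (S : ℝ) {ε : ℝ} (hε : 0 < ε) :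
    ∃ τ : ℝ, 0 < τ ∧ ∀ᶠ h : ℝ in 𝓝[>] 0, ∀ m n : ℕ, (m : ℝ) * h ≤ S → (n : ℝ) * h ≤ S →
      |(m : ℝ) * h - n * h| ≤ τ → q ((F h ^ m) x - (F h ^ n) x) ≤ ε := by
  obtain ⟨q', hq', hb⟩ := hE q hq S
  obtain ⟨τ, hτ, hev⟩ := eventually_pow_sub_le hE hd hq' x hε
  refine ⟨τ, hτ, ?_⟩
  filter_upwards [hev, self_mem_nhdsWithin] with h h1 h0
  have h0 : 0 < h := h0
  have key : ∀ m n : ℕ, n ≤ m → (n : ℝ) * h ≤ S → (m : ℝ) * h - n * h ≤ τ →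
      q ((F h ^ m) x - (F h ^ n) x) ≤ ε := by
    intro m n hnm hn hmn
    have e : (F h ^ m) x - (F h ^ n) x = (F h ^ n) ((F h ^ (m - n)) x - x) := by
      rw [map_sub, ← mul_apply_eq_comp, ← pow_add, Nat.add_sub_cancel' hnm]
    rw [e]
    refine (hb h h0.le n hn _).trans (h1 _ ?_)
    rw [Nat.cast_sub hnm, sub_mul]
    exact hmn
  intro m n hm hn hmn
  rcases le_total n m with hnm | hnm
  · exact key m n hnm hn ((le_abs_self _).trans hmn)
  · rw [map_sub_rev]
    exact key n m hnm hm ((neg_sub ((m : ℝ) * h) _).symm.le.trans ((neg_le_abs _).trans hmn))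

theorem PowTendsto.of_floor (hp : WithSeminorms p) (hE : EquicontinuousPowers F)
    (hd : Dense {x : X | ∃ y : X, (x, y) ∈ asympGraph F}) (h𝓕 : 𝓕 ≤ 𝓝[>] 0)
    {x y : X} {v : ℝ} (hv : 0 ≤ v)
    (h : Tendsto (fun h => (F h ^ ⌊v / h⌋₊) x) 𝓕 (𝓝 y)) : PowTendsto F 𝓕 x v y := by
  intro m hm
  rw [tendsto_iff_seminorm hp] at h ⊢
  intro q hq ε hε
  obtain ⟨τ, hτ, hev⟩ := eventually_pow_sub_pow_le hE hd hq x (v + 1) (half_pos hε)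
  have hfl := tendsto_floor_div_mul h𝓕 hv
  have hdiff := (hm.sub hfl).abs
  rw [sub_self, abs_zero] at hdiff
  filter_upwards [h q hq _ (half_pos hε), h𝓕 hev, hm.eventually_le_const (lt_add_one v),
    hfl.eventually_le_const (lt_add_one v), hdiff.eventually_le_const hτ] with h g1 g2 g3 g4 g5
  have e : (F h ^ m h) x - y
      = ((F h ^ m h) x - (F h ^ ⌊v / h⌋₊) x) + ((F h ^ ⌊v / h⌋₊) x - y) := by abel
  rw [e]
  refine (map_add_le_add q _ _).trans_lt ?_
  linarith [g2 _ _ g3 g4 g5]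

theorem PowTendsto.of_add (hp : WithSeminorms p) (hE : EquicontinuousPowers F)
    (h𝓕 : 𝓕 ≤ 𝓝[>] 0) {x y z : X} {a b : ℝ} (ha : 0 ≤ a)
    (hy : PowTendsto F 𝓕 x a y) (hz : PowTendsto F 𝓕 x (a + b) z) : PowTendsto F 𝓕 y b z := by
  intro m hm
  have hfl := tendsto_floor_div_mul h𝓕 ha
  have h1 := hy _ hfl
  have h2 := hz (fun h => m h + ⌊a / h⌋₊) (by
    rw [add_comm a b]
    refine (hm.add hfl).congr fun h => ?_
    push_cast
    ring)
  rw [tendsto_iff_seminorm hp] at h1 h2 ⊢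
  intro q hq ε hε
  obtain ⟨q', hq', hb⟩ := hE q hq (b + 1)
  filter_upwards [h1 q' hq' _ (half_pos hε), h2 q hq _ (half_pos hε),
    hm.eventually_le_const (lt_add_one b), h𝓕 self_mem_nhdsWithin] with h g1 g2 g3 h0
  have h0 : 0 < h := h0
  have e : (F h ^ m h) y - z
      = ((F h ^ (m h + ⌊a / h⌋₊)) x - z) - (F h ^ m h) ((F h ^ ⌊a / h⌋₊) x - y) := by
    rw [pow_add, mul_apply_eq_comp, map_sub]
    abel
  rw [e]
  refine (map_sub_le_add q _ _).trans_lt ?_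
  linarith [hb h h0.le _ g3 ((F h ^ ⌊a / h⌋₊) x - y)]

theorem PowTendsto.sub_sub_le [𝓕.NeBot] (hp : WithSeminorms p)
    (h𝓕 : 𝓕 ≤ 𝓝[>] 0) {x y z : X} (hxy : (x, y) ∈ asympGraph F)
    {q : Seminorm 𝕜 X} (hq : Continuous q) {τ ε b : ℝ} (hε : 0 < ε)
    (hy : ∀ᶠ h : ℝ in 𝓕, ∀ m : ℕ, (m : ℝ) * h ≤ τ → q ((F h ^ m) y - y) ≤ ε)
    (hb : 0 ≤ b) (hbτ : b ≤ τ) (hz : PowTendsto F 𝓕 x b z) :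
    q (z - x - (b : 𝕜) • y) ≤ ε * b := by
  refine le_of_forall_pos_le_add fun η hη => ?_
  have hη3 : 0 < η / 3 := by positivity
  have hqy : 0 < 1 + q y := by have := apply_nonneg q y; positivity
  obtain ⟨h, g1, g2, h0, g3⟩ := ((eventually_pow_sub_sub_le hxy hq h𝓕 hy hη3).and
    (((tendsto_iff_seminorm hp).1 (hz _ (tendsto_floor_div_mul h𝓕 hb)) q hq _ hη3).and
    (h𝓕 (eventually_Ioo_nhdsGT (div_pos hη3 hqy))))).exists
  have u1 := floor_div_mul_le hb h0
  have u2 := lt_floor_div_mul_add b h0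
  have g1 := g1 _ (u1.trans hbτ)
  have e : z - x - (b : 𝕜) • y
      = ((F h ^ ⌊b / h⌋₊) x - x - (((⌊b / h⌋₊ : ℝ) * h : ℝ) : 𝕜) • y)
        - ((F h ^ ⌊b / h⌋₊) x - z) - ((b - (⌊b / h⌋₊ : ℝ) * h : ℝ) : 𝕜) • y := by
    push_cast
    module
  have b3 : q (((b - (⌊b / h⌋₊ : ℝ) * h : ℝ) : 𝕜) • y) ≤ η / 3 := by
    rw [seminorm_smul_ofReal q (by linarith)]
    rw [lt_div_iff₀ hqy] at g3
    have := mul_le_mul_of_nonneg_right (show b - (⌊b / h⌋₊ : ℝ) * h ≤ h by linarith)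
      (apply_nonneg q y)
    nlinarith
  rw [e]
  refine (seminorm_sub_le q (seminorm_sub_le q g1 g2.le) b3).trans ?_
  nlinarith

end PowTendsto

/-! ### Limits of powers are solutions -/

section Existence

variable {𝕜 X ι : Type*} [RCLike 𝕜] [AddCommGroup X] [Module 𝕜 X] [TopologicalSpace X]
  [IsTopologicalAddGroup X] [ContinuousSMul 𝕜 X] {p : SeminormFamily 𝕜 X ι}
  {F : ℝ → X →L[𝕜] X} {𝓕 : Filter ℝ}

/-- The limit trajectory of the powers is differentiable from the right. -/
theorem exists_right_expansion [𝓕.NeBot] (hp : WithSeminorms p) (hE : EquicontinuousPowers F)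
    (hd : Dense {x : X | ∃ y : X, (x, y) ∈ asympGraph F}) (h𝓕 : 𝓕 ≤ 𝓝[>] 0)
    {x : X} {f g : ℝ → X} {l : ℝ} (hf : ∀ s ∈ Set.Ico 0 l, PowTendsto F 𝓕 x s (f s))
    (hg : ∀ s ∈ Set.Ico 0 l, (f s, g s) ∈ asympGraph F) {a : ℝ} (ha : a ∈ Set.Ico 0 l)
    {q : Seminorm 𝕜 X} (hq : Continuous q) {ε : ℝ} (hε : 0 < ε) :
    ∃ τ : ℝ, 0 < τ ∧ ∀ b : ℝ, 0 ≤ b → b ≤ τ → a + b < l →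
      q (f (a + b) - f a - (b : 𝕜) • g a) ≤ ε * b := by
  obtain ⟨τ, hτ, hev⟩ := eventually_pow_sub_le hE hd hq (g a) hε
  refine ⟨τ, hτ, fun b hb hbτ hab => ?_⟩
  exact PowTendsto.sub_sub_le hp h𝓕 (hg a ha) hq hε (h𝓕 hev) hb hbτ
    ((hf a ha).of_add hp hE h𝓕 ha.1 (hf (a + b) ⟨by linarith [ha.1], hab⟩))

/-- The powers of `F` transport the velocities `g` of the limit trajectory as they transport the
trajectory itself: difference quotients are transported, and the right derivative allows the passage
to the limit by equicontinuity. -/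
theorem PowTendsto.velocity [𝓕.NeBot] (hp : WithSeminorms p) (hE : EquicontinuousPowers F)
    (hd : Dense {x : X | ∃ y : X, (x, y) ∈ asympGraph F}) (h𝓕 : 𝓕 ≤ 𝓝[>] 0)
    {x : X} {f g : ℝ → X} {l : ℝ} (hf : ∀ s ∈ Set.Ico 0 l, PowTendsto F 𝓕 x s (f s))
    (hg : ∀ s ∈ Set.Ico 0 l, (f s, g s) ∈ asympGraph F) {a b : ℝ} (ha : 0 ≤ a) (hb : 0 ≤ b)
    (hab : a + b < l) : PowTendsto F 𝓕 (g a) b (g (a + b)) := by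
  intro m hm
  rw [tendsto_iff_seminorm hp]
  intro q hq ε hε
  have hε5 : 0 < ε / 5 := by positivity
  obtain ⟨q', hq', hbd⟩ := hE q hq (b + 1)
  have hal : a ∈ Set.Ico 0 l := ⟨ha, by linarith⟩
  have habl : a + b ∈ Set.Ico 0 l := ⟨by linarith, hab⟩
  obtain ⟨τ₁, hτ₁, h1⟩ := exists_right_expansion hp hE hd h𝓕 hf hg hal hq' hε5
  obtain ⟨τ₂, hτ₂, h2⟩ := exists_right_expansion hp hE hd h𝓕 hf hg habl hq hε5
  obtain ⟨δ, hδ, hδ'⟩ := exists_between (lt_min (lt_min hτ₁ hτ₂) (sub_pos.2 hab))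
  have d1 : δ ≤ τ₁ := hδ'.le.trans ((min_le_left _ _).trans (min_le_left _ _))
  have d2 : δ ≤ τ₂ := hδ'.le.trans ((min_le_left _ _).trans (min_le_right _ _))
  have d3 : δ < l - (a + b) := hδ'.trans_le (min_le_right _ _)
  have c1 := (hf a hal).of_add hp hE h𝓕 ha (hf (a + b) habl) m hm
  have c2 := (hf (a + δ) ⟨by linarith, by linarith⟩).of_add hp hE h𝓕 (by linarith)
    (b := b) (z := f (a + b + δ)) (by
      rw [add_right_comm]
      exact hf (a + b + δ) ⟨by linarith, by linarith⟩) m hm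
  rw [tendsto_iff_seminorm hp] at c1 c2
  have hη : 0 < ε / 5 * δ := by positivity
  filter_upwards [c1 q hq _ hη, c2 q hq _ hη, hm.eventually_le_const (lt_add_one b),
    h𝓕 self_mem_nhdsWithin] with h g1 g2 g3 h0
  have h0 : 0 < h := h0
  have k1 := (hbd h h0.le _ g3 _).trans (h1 δ hδ.le d1 (by linarith))
  have k2 := h2 δ hδ.le d2 (by linarith)
  -- Replace both velocities by difference quotients with increment `δ`, multiplied out by `δ`.
  have e : (δ : 𝕜) • ((F h ^ m h) (g a) - g (a + b))
      = ((f (a + b + δ) - f (a + b) - (δ : 𝕜) • g (a + b))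
        - (F h ^ m h) (f (a + δ) - f a - (δ : 𝕜) • g a))
        + (((F h ^ m h) (f (a + δ)) - f (a + b + δ)) - ((F h ^ m h) (f a) - f (a + b))) := by
    simp only [map_sub, map_smul]
    module
  have key := seminorm_add_le q (seminorm_sub_le q k2 k1) (seminorm_sub_le q g2.le g1.le)
  rw [← e, seminorm_smul_ofReal q hδ.le] at key
  have : δ * q ((F h ^ m h) (g a) - g (a + b)) ≤ δ * (4 * (ε / 5)) := by linarith
  have := le_of_mul_le_mul_left this hδ
  linarith

/-- Strong continuity at zero holds uniformly over the velocities, because they all arise from the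
initial velocity `g 0` by powers of `F`. -/
theorem exists_uniform_velocity_bound [𝓕.NeBot] (hp : WithSeminorms p)
    (hE : EquicontinuousPowers F)
    (hd : Dense {x : X | ∃ y : X, (x, y) ∈ asympGraph F}) (h𝓕 : 𝓕 ≤ 𝓝[>] 0)
    {x : X} {f g : ℝ → X} {l : ℝ} (hf : ∀ s ∈ Set.Ico 0 l, PowTendsto F 𝓕 x s (f s))
    (hg : ∀ s ∈ Set.Ico 0 l, (f s, g s) ∈ asympGraph F)
    {q : Seminorm 𝕜 X} (hq : Continuous q) {ε : ℝ} (hε : 0 < ε) :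
    ∃ τ : ℝ, 0 < τ ∧ ∀ a ∈ Set.Ico 0 l, ∀ᶠ h : ℝ in 𝓕, ∀ m : ℕ, (m : ℝ) * h ≤ τ →
      q ((F h ^ m) (g a) - g a) ≤ ε := by
  have hε3 : 0 < ε / 3 := by positivity
  obtain ⟨q₁, hq₁, hb₁⟩ := hE q hq l
  obtain ⟨q₂, hq₂, hb₂⟩ := hE q hq 1
  obtain ⟨τ, hτ, hev⟩ := eventually_pow_sub_le hE hd hq₁ (g 0) hε3
  refine ⟨min τ 1, by positivity, fun a ha => ?_⟩
  have hlim := PowTendsto.velocity hp hE hd h𝓕 hf hg le_rfl ha.1 (by simpa using ha.2) _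
    (tendsto_floor_div_mul h𝓕 ha.1)
  rw [zero_add, tendsto_iff_seminorm hp] at hlim
  filter_upwards [h𝓕 hev, hlim q hq _ hε3, hlim q₂ hq₂ _ hε3,
    h𝓕 self_mem_nhdsWithin] with h g1 g2 g3 h0 m hm
  have h0 : 0 < h := h0
  have e : (F h ^ m) (g a) - g a
      = (F h ^ ⌊a / h⌋₊) ((F h ^ m) (g 0) - g 0) + ((F h ^ ⌊a / h⌋₊) (g 0) - g a)
        - (F h ^ m) ((F h ^ ⌊a / h⌋₊) (g 0) - g a) := by
    have : (F h ^ ⌊a / h⌋₊) ((F h ^ m) (g 0)) = (F h ^ m) ((F h ^ ⌊a / h⌋₊) (g 0)) := by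
      rw [← mul_apply_eq_comp, ← mul_apply_eq_comp, ← pow_add, ← pow_add, add_comm]
    rw [map_sub, map_sub, this]
    abel
  rw [e]
  refine (seminorm_sub_le q (seminorm_add_le q
    ((hb₁ h h0.le _ ((floor_div_mul_le ha.1 h0).trans ha.2.le) _).trans
      (g1 m (hm.trans (min_le_left _ _)))) g2.le)
    ((hb₂ h h0.le m (hm.trans (min_le_right _ _)) _).trans g3.le)).trans ?_
  linarith

/-- A trajectory that is a limit of powers and runs in the domain of `A` is a local solution. -/
theorem isLocalSolution_of_powTendsto [T2Space X] [𝓕.NeBot] (hp : WithSeminorms p)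
    (hE : EquicontinuousPowers F)
    (hd : Dense {x : X | ∃ y : X, (x, y) ∈ asympGraph F}) (h𝓕 : 𝓕 ≤ 𝓝[>] 0)
    {A : X →ₗ.[𝕜] X} (hA : (A.graph : Set (X × X)) ⊆ asympGraph F)
    {x : X} {f g : ℝ → X} {l : ℝ} (hl : 0 < l)
    (hf : ∀ s ∈ Set.Ico 0 l, PowTendsto F 𝓕 x s (f s))
    (hg : ∀ s ∈ Set.Ico 0 l, (f s, g s) ∈ A.graph) : IsLocalSolution A l x f := by
  have hg' : ∀ s ∈ Set.Ico 0 l, (f s, g s) ∈ asympGraph F := fun s hs => hA (hg s hs)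
  constructor
  · have := hf 0 ⟨le_rfl, hl⟩ (fun _ => 0) (by simp)
    simpa using tendsto_nhds_unique this (by simp)
  intro s hs
  obtain ⟨z, hz1, hz2⟩ := A.mem_graph_iff.1 (hg s hs)
  have hz1 : (z : X) = f s := hz1
  have hz2 : A z = g s := hz2
  have hdom : f s ∈ A.domain := hz1 ▸ z.2
  refine ⟨hdom, ?_⟩
  have hval : A ⟨f s, hdom⟩ = g s := by
    rw [← hz2]
    congr 1
    exact Subtype.ext hz1.symm
  rw [hval, tendsto_slope_Ico_iff hp]
  intro q hq ε hε
  obtain ⟨τ, hτ, hunif⟩ :=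
    exists_uniform_velocity_bound hp hE hd h𝓕 hf hg' hq (half_pos hε)
  have bf : ∀ a b : ℝ, 0 ≤ a → 0 ≤ b → b ≤ τ → a + b < l →
      q (f (a + b) - f a - (b : 𝕜) • g a) ≤ ε / 2 * b := fun a b ha hb hbτ hab =>
    PowTendsto.sub_sub_le hp h𝓕 (hg' a ⟨ha, by linarith⟩) hq (half_pos hε)
      (hunif a ⟨ha, by linarith⟩) hb hbτ
      ((hf a ⟨ha, by linarith⟩).of_add hp hE h𝓕 ha (hf (a + b) ⟨by linarith, hab⟩))
  have bg : ∀ a b : ℝ, 0 ≤ a → 0 ≤ b → b ≤ τ → a + b < l → q (g (a + b) - g a) ≤ ε / 2 := by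
    intro a b ha hb hbτ hab
    have hlim := PowTendsto.velocity hp hE hd h𝓕 hf hg' ha hb hab _ (tendsto_floor_div_mul h𝓕 hb)
    refine le_of_tendsto ((hq.tendsto _).comp (hlim.sub_const (g a))) ?_
    filter_upwards [hunif a ⟨ha, by linarith⟩, h𝓕 self_mem_nhdsWithin] with h g1 h0
    exact g1 _ ((floor_div_mul_le hb h0).trans hbτ)
  refine ⟨τ, hτ, fun v hv hvs => ?_⟩
  rcases le_total s v with hsv | hvs'
  · have h0 : 0 ≤ v - s := sub_nonneg.2 hsv
    rw [abs_of_nonneg h0] at hvs ⊢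
    have := bf s (v - s) hs.1 h0 hvs.le (by linarith [hv.2])
    rw [add_sub_cancel] at this
    nlinarith
  · have h0 : 0 ≤ s - v := sub_nonneg.2 hvs'
    rw [abs_sub_comm, abs_of_nonneg h0] at hvs ⊢
    have k1 := bf v (s - v) hv.1 h0 hvs.le (by linarith [hs.2])
    have k2 := bg v (s - v) hv.1 h0 hvs.le (by linarith [hs.2])
    rw [add_sub_cancel] at k1 k2
    -- To the left of `s`, expand at `v` instead and use the continuity of `g`.
    have e : f v - f s - ((v - s : ℝ) : 𝕜) • g s
        = ((s - v : ℝ) : 𝕜) • (g s - g v) - (f s - f v - ((s - v : ℝ) : 𝕜) • g v) := by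
      push_cast
      module
    have k3 : q (((s - v : ℝ) : 𝕜) • (g s - g v)) ≤ (s - v) * (ε / 2) := by
      rw [seminorm_smul_ofReal q h0]
      exact mul_le_mul_of_nonneg_left k2 h0
    rw [e]
    refine (seminorm_sub_le q k3 k1).trans ?_
    linarith

end Existence

/-! ### Weak limits in closed graphs and diagonal subsequences -/

section Compactness

variable {𝕜 X ι : Type*} [RCLike 𝕜] [AddCommGroup X] [Module 𝕜 X] [TopologicalSpace X]
  [IsTopologicalAddGroup X] [ContinuousSMul 𝕜 X] {p : SeminormFamily 𝕜 X ι}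

/-- A closed subspace of `X × X` is weakly sequentially closed (Hahn–Banach). -/
theorem mem_of_weakTendsto (hp : WithSeminorms p) {G : Submodule 𝕜 (X × X)}
    (hG : IsClosed (G : Set (X × X))) {u v : ℕ → X} (huv : ∀ n, (u n, v n) ∈ G) {x y : X}
    (hu : WeakTendsto 𝕜 u x) (hv : WeakTendsto 𝕜 v y) : (x, y) ∈ G := by
  let _ : Module ℝ X := Module.compHom X (algebraMap ℝ 𝕜)
  have : IsScalarTower ℝ 𝕜 X := IsScalarTower.of_algebraMap_smul fun _ _ => rfl
  have : LocallyConvexSpace ℝ X := hp.toLocallyConvexSpace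
  by_contra hxy
  have hconv : Convex ℝ (G : Set (X × X)) := by
    intro a ha b hb r s _ _ _
    exact G.add_mem (G.smul_mem (algebraMap ℝ 𝕜 r) ha) (G.smul_mem (algebraMap ℝ 𝕜 s) hb)
  obtain ⟨φ, c, hφ, hc⟩ := RCLike.geometric_hahn_banach_closed_point (𝕜 := 𝕜) hconv hG hxy
  have hsplit : ∀ a b : X, φ (a, b) = φ.comp (ContinuousLinearMap.inl 𝕜 X X) a
      + φ.comp (ContinuousLinearMap.inr 𝕜 X X) b := by
    intro a b
    simp [← map_add]
  have hlim : Tendsto (fun n => φ (u n, v n)) atTop (𝓝 (φ (x, y))) := by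
    simp only [hsplit]
    exact (hu _).add (hv _)
  have := le_of_tendsto ((RCLike.continuous_re.tendsto _).comp hlim)
    (Eventually.of_forall fun n => (hφ _ (huv n)).le)
  linarith

/-- Diagonal extraction: countably many sequences, each with convergent sub-subsequences, converge
along a common subsequence. -/
theorem exists_strictMono_forall_tendsto {Y : Type*} [TopologicalSpace Y] {u : ℕ → ℕ → Y}
    (hu : ∀ i, SubseqCompact (u i)) :
    ∃ φ : ℕ → ℕ, StrictMono φ ∧ ∀ i, ∃ x : Y, Tendsto (fun k => u i (φ k)) atTop (𝓝 x) := by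
  choose b hb x hx using hu
  let Φ : ℕ → {a : ℕ → ℕ // StrictMono a} := fun n =>
    Nat.rec ⟨id, strictMono_id⟩ (fun i a => ⟨a.1 ∘ b i a.1 a.2, a.2.comp (hb i a.1 a.2)⟩) n
  have hsucc : ∀ i, (Φ (i + 1)).1 = (Φ i).1 ∘ b i (Φ i).1 (Φ i).2 := fun _ => rfl
  have hfac : ∀ i j, ∃ θ : ℕ → ℕ, StrictMono θ ∧ (Φ (i + j)).1 = (Φ i).1 ∘ θ := by
    intro i j
    induction j with
    | zero => exact ⟨id, strictMono_id, rfl⟩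
    | succ j ih =>
      obtain ⟨θ, hθ, h⟩ := ih
      refine ⟨θ ∘ b (i + j) (Φ (i + j)).1 (Φ (i + j)).2, hθ.comp (hb _ _ _), ?_⟩
      rw [← add_assoc, hsucc, ← Function.comp_assoc]
      exact congrArg (fun c => c ∘ _) h
  refine ⟨fun k => (Φ k).1 k, strictMono_nat_of_lt_succ fun k => ?_, fun i => ?_⟩
  · rw [hsucc]
    exact (Φ k).2 ((Nat.lt_succ_self k).trans_le ((hb k _ _).le_apply))
  · refine ⟨x i (Φ i).1 (Φ i).2, ?_⟩
    choose θ hθ hθe using fun j => hfac (i + 1) j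
    have hlim : Tendsto (fun k => u i ((Φ (i + 1)).1 k)) atTop (𝓝 (x i (Φ i).1 (Φ i).2)) :=
      hx i (Φ i).1 (Φ i).2
    have hidx : Tendsto (fun k => θ (k - (i + 1)) k) atTop atTop :=
      tendsto_atTop_mono (fun k => (hθ (k - (i + 1))).le_apply) tendsto_id
    refine (hlim.comp hidx).congr' ?_
    filter_upwards [eventually_ge_atTop (i + 1)] with k hk
    have := congrFun (hθe (k - (i + 1))) k
    rw [Nat.add_sub_cancel' hk] at this
    simp only [Function.comp_apply] at this ⊢
    rw [this]

end Compactness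

/-! ### The two conditions and local solvability -/

section Conditions

theorem approx_eq {𝕜 X : Type*} [RCLike 𝕜] [AddCommGroup X] [Module 𝕜 X]
    [TopologicalSpace X] (F : ℝ → X →L[𝕜] X) (t : ℝ) (x : X) (s : ℝ) (n : ℕ) :
    approx F t x s n = (F (t / (n : ℝ)) ^ ⌊s / (t / (n : ℝ))⌋₊) x := by
  rw [approx, div_div_eq_mul_div, mul_comm s]

variable {𝕜 X ι : Type*} [RCLike 𝕜] [AddCommGroup X] [Module 𝕜 X] [TopologicalSpace X]
  [IsTopologicalAddGroup X] [ContinuousSMul 𝕜 X] {p : SeminormFamily 𝕜 X ι}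
  {F : ℝ → X →L[𝕜] X}

theorem tendsto_div_nat_nhdsGT {t : ℝ} (ht : 0 < t) :
    Tendsto (fun n : ℕ => t / (n : ℝ)) atTop (𝓝[>] 0) := by
  refine tendsto_nhdsWithin_iff.2 ⟨tendsto_const_div_atTop_nhds_zero_nat t, ?_⟩
  filter_upwards [eventually_gt_atTop 0] with n hn
  have : (0 : ℝ) < n := by exact_mod_cast hn
  exact div_pos ht this

/-- Condition (a) provides one subsequence along which the approximants converge at all times:
extract it for a dense sequence of times, and use equicontinuity in time. -/
theorem CondA.exists_subseq (hp : WithSeminorms p) (hE : EquicontinuousPowers F)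
    (hd : Dense {x : X | ∃ y : X, (x, y) ∈ asympGraph F}) {t l : ℝ} (ht : 0 < t) {x : X}
    (hA : CondA F t l x) :
    ∃ φ : ℕ → ℕ, StrictMono φ ∧ ∀ s ∈ Set.Ico 0 l,
      ∃ y : X, Tendsto (fun k => approx F t x s (φ k)) atTop (𝓝 y) := by
  rcases le_or_gt l 0 with hl | hl
  · exact ⟨id, strictMono_id, fun s hs => absurd (hs.1.trans_lt hs.2) hl.not_gt⟩
  let d : ℕ → ℝ := fun i => if TopologicalSpace.denseSeq ℝ i ∈ Set.Ico 0 l then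
    TopologicalSpace.denseSeq ℝ i else 0
  have hdl : ∀ i, d i ∈ Set.Ico 0 l := by
    intro i
    by_cases h : TopologicalSpace.denseSeq ℝ i ∈ Set.Ico 0 l
    · simp only [d, if_pos h]
      exact h
    · simp only [d, if_neg h]
      exact ⟨le_rfl, hl⟩
  obtain ⟨φ, hφ, hlim⟩ := exists_strictMono_forall_tendsto fun i => hA (d i) (hdl i)
  refine ⟨φ, hφ, fun s hs => ?_⟩
  obtain ⟨b, hb, y, hy⟩ := hA s hs φ hφ
  refine ⟨y, (tendsto_iff_seminorm hp).2 fun q hq ε hε => ?_⟩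
  have he : 0 < ε / 6 := by positivity
  obtain ⟨τ, hτ, hev⟩ := eventually_pow_sub_pow_le hE hd hq x l he
  obtain ⟨r, ⟨i, rfl⟩, hr1, hr2⟩ := (TopologicalSpace.denseRange_denseSeq ℝ).exists_between
    (lt_min hs.2 (lt_add_of_pos_right s (half_pos hτ)))
  have hil : TopologicalSpace.denseSeq ℝ i ∈ Set.Ico 0 l :=
    ⟨hs.1.trans hr1.le, hr2.trans_le (min_le_left _ _)⟩
  have hdi : d i = TopologicalSpace.denseSeq ℝ i := if_pos hil
  rw [← hdi] at hil hr1 hr2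
  have hr2 := hr2.trans_le (min_le_right _ _)
  obtain ⟨w, hw⟩ := hlim i
  have hclose : ∀ᶠ n : ℕ in atTop, q (approx F t x s n - approx F t x (d i) n) ≤ ε / 6 := by
    filter_upwards [(tendsto_div_nat_nhdsGT ht).eventually hev,
      (tendsto_div_nat_nhdsGT ht).eventually (eventually_Ioo_nhdsGT (half_pos hτ))]
      with n h1 ⟨h2, h3⟩
    rw [approx_eq, approx_eq]
    have u1 := floor_div_mul_le hs.1 h2
    have u2 := floor_div_mul_le hil.1 h2
    have u3 := lt_floor_div_mul_add s h2
    have u4 := lt_floor_div_mul_add (d i) h2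
    refine h1 _ _ (u1.trans hs.2.le) (u2.trans hil.2.le) ?_
    rw [abs_le]
    constructor <;> linarith
  have hclose' := hφ.tendsto_atTop.eventually hclose
  have hw' := (tendsto_iff_seminorm hp).1 hw q hq _ he
  obtain ⟨j, j1, j2, j3⟩ := ((hb.tendsto_atTop.eventually hclose').and
    ((hb.tendsto_atTop.eventually hw').and ((tendsto_iff_seminorm hp).1 hy q hq _ he))).exists
  filter_upwards [hclose', hw'] with k k1 k2
  -- Compare with the limit `w` at the nearby time `d i`, once at `k` and once at a far index
  -- `b j` of the sub-subsequence converging to `y`.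
  have e : approx F t x s (φ k) - y
      = ((approx F t x s (φ k) - approx F t x (d i) (φ k)) + (approx F t x (d i) (φ k) - w))
        + ((approx F t x s (φ (b j)) - y)
          - ((approx F t x s (φ (b j)) - approx F t x (d i) (φ (b j)))
            + (approx F t x (d i) (φ (b j)) - w))) := by abel
  rw [e]
  refine (seminorm_add_le q (seminorm_add_le q k1 k2.le)
    (seminorm_sub_le q j3.le (seminorm_add_le q j1 j2.le))).trans_lt ?_
  linarith

theorem exists_isLocalSolution_of_condA_of_condB [T2Space X] (hp : WithSeminorms p)
    (hE : EquicontinuousPowers F)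
    (hd : Dense {x : X | ∃ y : X, (x, y) ∈ asympGraph F}) {A : X →ₗ.[𝕜] X}
    (hA : (A.graph : Set (X × X)) ⊆ asympGraph F) (hAc : IsClosed (A.graph : Set (X × X)))
    {t l : ℝ} (ht : 0 < t) (hl : 0 < l) {x : X} (ha : CondA F t l x) (hb : CondB A F t l x) :
    ∃ f : ℝ → X, IsLocalSolution A l x f := by
  obtain ⟨φ, hφ, hlim⟩ := ha.exists_subseq hp hE hd ht
  have hsub : Tendsto (fun k => t / (φ k : ℝ)) atTop (𝓝[>] 0) :=
    (tendsto_div_nat_nhdsGT ht).comp hφ.tendsto_atTop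
  have hval : ∀ s : ℝ, ∃ z : X × X, s ∈ Set.Ico 0 l →
      Tendsto (fun k => approx F t x s (φ k)) atTop (𝓝 z.1) ∧ z ∈ A.graph := by
    intro s
    by_cases hs : s ∈ Set.Ico 0 l
    · obtain ⟨z, hz⟩ := hlim s hs
      obtain ⟨u, hu, hAu⟩ := hb s hs
      obtain ⟨b, hbm, y, hy⟩ := hAu φ hφ
      refine ⟨(z, y), fun _ => ⟨hz, mem_of_weakTendsto hp hAc
        (fun k => A.mem_graph (u (φ (b k)))) (fun ψ => ?_) hy⟩⟩
      have h1 := (((ψ.continuous.tendsto z).comp hz).comp hbm.tendsto_atTop).sub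
        ((hu ψ).comp ((hφ.comp hbm).tendsto_atTop))
      rw [map_zero, sub_zero] at h1
      refine h1.congr fun k => ?_
      simp
    · exact ⟨0, fun h => absurd h hs⟩
  choose z hz using hval
  refine ⟨fun s => (z s).1, isLocalSolution_of_powTendsto (𝓕 := map (fun k => t / (φ k : ℝ)) atTop)
    hp hE hd hsub hA (g := fun s => (z s).2) hl (fun s hs => ?_) fun s hs => (hz s hs).2⟩
  refine PowTendsto.of_floor hp hE hd hsub hs.1 (tendsto_map'_iff.2 ?_)
  refine (hz s hs).1.congr fun k => ?_
  rw [approx_eq]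
  rfl

/-- A local solution forces both conditions: the approximants converge to it, and its values serve
as the vectors in condition (b). -/
theorem IsLocalSolution.condA_and_condB (hp : WithSeminorms p) (hE : EquicontinuousPowers F)
    (hd : Dense {x : X | ∃ y : X, (x, y) ∈ asympGraph F}) {A : X →ₗ.[𝕜] X}
    (hA : (A.graph : Set (X × X)) ⊆ asympGraph F) {t l : ℝ} (ht : 0 < t) {x : X} {f : ℝ → X}
    (hf : IsLocalSolution A l x f) : CondA F t l x ∧ CondB A F t l x := by
  have hlim : ∀ s ∈ Set.Ico 0 l, Tendsto (approx F t x s) atTop (𝓝 (f s)) := by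
    intro s hs
    refine ((hf.tendsto_pow hp hE hd hA hs).comp (tendsto_div_nat_nhdsGT ht)).congr fun n => ?_
    rw [approx_eq]
    rfl
  constructor
  · exact fun s hs a ha => ⟨id, strictMono_id, f s, (hlim s hs).comp ha.tendsto_atTop⟩
  · intro s hs
    obtain ⟨hdom, -⟩ := hf.deriv s hs
    refine ⟨fun _ => ⟨f s, hdom⟩, fun ψ => ?_, fun a ha =>
      ⟨id, strictMono_id, A ⟨f s, hdom⟩, fun ψ => tendsto_const_nhds⟩⟩
    have := (hlim s hs).sub_const (f s)
    rw [sub_self] at this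
    exact (ψ.continuous.tendsto 0).comp this

theorem IsLocalSolution.tendsto_div_pow (hp : WithSeminorms p) (hE : EquicontinuousPowers F)
    (hF0 : F 0 = ContinuousLinearMap.id 𝕜 X)
    (hd : Dense {x : X | ∃ y : X, (x, y) ∈ asympGraph F}) {A : X →ₗ.[𝕜] X}
    (hA : (A.graph : Set (X × X)) ⊆ asympGraph F) {l : ℝ} {x : X} {f : ℝ → X}
    (hf : IsLocalSolution A l x f) {v : ℝ} (hv : v ∈ Set.Ico 0 l) :
    Tendsto (fun n : ℕ => (F (v / (n : ℝ)) ^ n) x) atTop (𝓝 (f v)) := by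
  rcases eq_or_lt_of_le hv.1 with rfl | hv0
  · refine tendsto_const_nhds.congr fun n => ?_
    rw [hf.init, zero_div, hF0, ← ContinuousLinearMap.one_def, one_pow, one_apply_eq_self]
  · refine ((hf.tendsto_pow hp hE hd hA hv).comp (tendsto_div_nat_nhdsGT hv0)).congr' ?_
    filter_upwards with n
    rw [Function.comp_apply, div_div_cancel₀ hv0.ne', Nat.floor_natCast]

end Conditions

end ChernoffLC

end

theorem theorem7p2 {𝕜 X ι : Type*} [RCLike 𝕜] [AddCommGroup X] [Module 𝕜 X]
    [TopologicalSpace X] [IsTopologicalAddGroup X] [ContinuousSMul 𝕜 X] [T2Space X]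
    (p : SeminormFamily 𝕜 X ι) (hp : WithSeminorms p)
    (Z : X →ₗ.[𝕜] X) (hZ : Dense (Z.domain : Set X))
    (F : ℝ → X →L[𝕜] X) (hF : ChernoffLC.ClassF p F) (hZF : Z ≤ ChernoffLC.effDeriv F)
    (t : ℝ) (ht : 0 < t) :
    Z.IsClosable ∧
    ∀ l : ℝ, 0 < l → ∀ h ∈ Z.closure.domain,
      ((∃ f : ℝ → X, ChernoffLC.IsLocalSolution Z.closure l h f) ↔
        (ChernoffLC.CondA F t l h ∧ ChernoffLC.CondB Z.closure F t l h)) ∧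
      (ChernoffLC.CondA F t l h ∧ ChernoffLC.CondB Z.closure F t l h →
        ∀ f : ℝ → X, ChernoffLC.IsLocalSolution Z.closure l h f →
          ∀ v ∈ Set.Ico 0 l,
            Tendsto (fun n : ℕ => ((F (v / (n : ℝ))) ^ n) h) atTop (𝓝 (f v))) := by
  obtain ⟨hcl, hA, hd⟩ := ChernoffLC.isClosable_of_le_effDeriv hp hF hZF
  have hE := hF.toClassE.equicontinuousPowers hp
  refine ⟨hcl, fun l hl h _ => ⟨⟨?_, ?_⟩, ?_⟩⟩
  · rintro ⟨f, hf⟩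
    exact hf.condA_and_condB hp hE hd hA ht
  · rintro ⟨ha, hb⟩
    exact ChernoffLC.exists_isLocalSolution_of_condA_of_condB hp hE hd hA hcl.closure_isClosed
      ht hl ha hb
  · intro _ f hf v hv
    exact hf.tendsto_div_pow hp hE hF.map_zero hd hA hv
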